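/- Let $n \ge 2$ be an even integer, let $q \ge 3$ be a prime power, and let $\mathbb F_q$ be the finite field with $q$ elements. For a finite-dimensional Lie algebra $L$ over $\mathbb F_q$, the breadth of $x \in L$ is the codimension $\dim L - \dim C_L(x)$ of its centralizer $C_L(x) = \{y \in L : [x,y] = 0\}$; $L$ is of breadth type $(0,n)$ if the set of breadths of the elements of $L$ is exactly $\{0,n\}$. $L$ is called stem if its center is contained in the derived subalgebra $[L,L]$, and $3$-step nilpotent if it is nilpotent of nilpotency class exactly $3$. Then, up to isomorphism of Lie algebras over $\mathbb F_q$, there exists exactly one finite-dimensional $3$-step nilpotent stem Lie algebra over $\mathbb F_q$ of breadth type $(0,n)$. -/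

import Mathlib

universe u v

namespace NilLie

/-- The centralizer `C_L(x)` of an element `x` of a Lie algebra `L`. -/
def centralizer (K : Type*) {L : Type*} [CommRing K] [LieRing L] [LieAlgebra K L] (x : L) :
    LieSubalgebra K L where
  carrier := {y | ⁅x, y⁆ = 0}
  zero_mem' := lie_zero x
  add_mem' := by
    intro a b ha hb
    simp only [Set.mem_ofPred_eq] at ha hb ⊢
    rw [lie_add, ha, hb, add_zero]
  smul_mem' := by
    intro c a ha
    simp only [Set.mem_ofPred_eq] at ha ⊢
    rw [lie_smul, ha, smul_zero]
  lie_mem' := by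
    intro a b ha hb
    simp only [Set.mem_ofPred_eq] at ha hb ⊢
    rw [leibniz_lie, ha, hb, zero_lie, lie_zero, add_zero]

/-- The breadth of `x`: the codimension of its centralizer in `L`. -/
noncomputable def breadth (K : Type*) {L : Type*} [Field K] [LieRing L] [LieAlgebra K L]
    (x : L) : ℕ :=
  Module.finrank K (L ⧸ (centralizer K x).toSubmodule)

/-- `L` has breadth type `(n₀, n₁, …, nᵣ)`: these are the distinct breadths of the elements of `L`,
written in increasing order. -/
def HasBreadthType (K L : Type*) [Field K] [LieRing L] [LieAlgebra K L] (l : List ℕ) : Prop :=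
  l.Pairwise (· < ·) ∧ ∀ b : ℕ, b ∈ l ↔ ∃ x : L, breadth K x = b

/-- `L` is a `c`-step nilpotent Lie algebra: it is nilpotent of nilpotency class exactly `c`. -/
def IsStepNilpotent (L : Type*) [LieRing L] (c : ℕ) : Prop :=
  LieRing.IsNilpotent L ∧ LieModule.nilpotencyLength L L = c

/-- `L` is a stem (or pure) Lie algebra: its center is contained in the derived subalgebra
`[L, L]`. -/
def IsStem (K L : Type*) [CommRing K] [LieRing L] [LieAlgebra K L] : Prop :=
  LieAlgebra.center K L ≤ ⁅(⊤ : LieIdeal K L), (⊤ : LieIdeal K L)⁆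

/-- `L` is a finite-dimensional `3`-step nilpotent stem Lie algebra over `K` of breadth type
`(0, n)`. -/
structure IsThreeStepStem (K L : Type*) [Field K] [LieRing L] [LieAlgebra K L] (n : ℕ) : Prop where
  finiteDimensional : FiniteDimensional K L
  threeStep : IsStepNilpotent L 3
  stem : IsStem K L
  breadthType : HasBreadthType K L [0, n]

end NilLie

/-!
The algebra is the free `3`-step nilpotent Lie algebra on two generators over the extension field
`F` of `K` of degree `m = n / 2`, viewed over `K`. It has dimension `5 * m`, with coordinates in
`F ^ 2`, `F`, `F ^ 2` along the lower central series, and each noncentral `x` has breadth `2 * m`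
because two of the three nonzero components of `⁅x, y⁆` can be prescribed and determine the third
(`FreeNil.breadth_eq`).

For uniqueness let `L` be such a Lie algebra, `Z` its center and `D = [L, L]`.

* *Ranks.* Let `r` be the rank of `ad x` modulo `Z`. If `⁅a, x⁆` is not central, then
  `⁅⁅a, x⁆, g⁆ = ⁅a, ⁅x, g⁆⁆ - ⁅x, ⁅a, g⁆⁆` bounds `n` by the dimensions of `⁅a, ⁅x, L⁆⁆` and
  `⁅x, ⁅a, L⁆⁆`, and this forces the ranks `r` of `x` and `a` to add up to `n`
  (`IsBreadthThree.codim_add_codim`). Applied to `x`, `a` and `x + a` it gives `r = m` for all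
  `x` outside the second center.
* *Dimensions.* Counting commuting pairs in two ways shows that the second center is `D` and that
  `dim D = dim Z + m` and `dim L = dim Z + 3 * m` (`IsBreadthThree.finrank_ctr2`,
  `IsBreadthThree.finrank_eq`). So an element of `D` outside `Z` has centralizer `D`, and, by the
  Jacobi identity, centralizers modulo `Z` of elements outside `D` are abelian modulo `Z`.
* *The field.* For `⁅e₁, e₂⁆` noncentral, the bracket between the centralizers of `e₁` and `e₂`
  modulo `Z` is a multiplication on `D / Z`. It has no zero divisors, and since the centralizer of
  `e₁ + s e₂` is abelian modulo `Z`, it satisfies `a (b s) = b (a s)`, so it is commutative and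
  associative. Thus `D / Z` is a field, isomorphic to `F`, and `L / D` is `F ^ 2` with the
  determinant as bracket (`IsBreadthThree.exists_isCoordinates`).
* *Normalization.* The Jacobi identity makes `⁅D, L⁆` the `F`-plane `F ^ 2`. Lifting `L / D` to
  `L` leaves an alternating error term with values in `Z`; the bracket of two elements on a line
  of `F ^ 2` lies on the corresponding line in `Z`. Read as an identity in the slope `s` of the
  line, this has a part linear and a part quadratic under scaling `s` by `K`. As `K` has an element
  other than `0` and `1`, both hold separately (`IsCoordinates.exists_cross`), and they say that the
  error term vanishes for a suitable lift (`IsCoordinates.exists_normalized`). The resulting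
  coordinates are an isomorphism with the free algebra (`IsBreadthThree.nonempty_lieEquiv`).
-/

namespace NilLie

open Module LieAlgebra

/-! ### Ranks of adjoint maps modulo the center -/

section Basic

variable (K L : Type*) [Field K] [LieRing L] [LieAlgebra K L]

/-- The center of `L`, as a subspace. -/
def ctr : Submodule K L := (LieAlgebra.center K L).toSubmodule

/-- The derived subalgebra `[L, L]`, as a subspace. -/
def der : Submodule K L := (⁅(⊤ : LieIdeal K L), (⊤ : LieIdeal K L)⁆).toSubmodule

/-- The second center of `L`: the elements `x` for which all `⁅x, y⁆` are central. -/
def ctr2 : Submodule K L where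
  carrier := {x | ∀ y, ⁅x, y⁆ ∈ ctr K L}
  zero_mem' := fun _ => by simp
  add_mem' := fun ha hb y => by rw [add_lie]; exact add_mem (ha y) (hb y)
  smul_mem' := fun c a ha y => by rw [smul_lie]; exact Submodule.smul_mem _ c (ha y)

/-- The centralizer of `x` modulo the center: the elements `y` for which `⁅x, y⁆` is central. -/
def relCent {L : Type*} [LieRing L] [LieAlgebra K L] (x : L) : Submodule K L :=
  (ctr K L).comap (ad K L x)

/-- The standing hypotheses on a Lie algebra of class three: its nilpotency class is exactly
three, its center is contained in the derived subalgebra, and every noncentral element has an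
adjoint map of rank `n`. -/
structure IsBreadthThree (n : ℕ) : Prop where
  lie_lie_lie : ∀ x y z w : L, ⁅x, ⁅y, ⁅z, w⁆⁆⁆ = 0
  exists_notMem : ∃ x : L, x ∉ ctr2 K L
  stem : ctr K L ≤ der K L
  rank : ∀ x ∉ ctr K L, finrank K (LinearMap.range (ad K L x)) = n

variable {K L}

lemma mem_ctr {x : L} : x ∈ ctr K L ↔ ∀ y : L, ⁅x, y⁆ = 0 := by
  unfold ctr
  rw [LieSubmodule.mem_toSubmodule, LieModule.mem_maxTrivSubmodule]
  exact forall_congr' fun y => by rw [← lie_skew, neg_eq_zero]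

lemma mem_ctr' {x : L} : x ∈ ctr K L ↔ ∀ y : L, ⁅y, x⁆ = 0 := by
  unfold ctr
  rw [LieSubmodule.mem_toSubmodule, LieModule.mem_maxTrivSubmodule]

lemma der_eq_span : der K L = Submodule.span K {z : L | ∃ x y : L, ⁅x, y⁆ = z} := by
  unfold der
  rw [LieSubmodule.lieIdeal_oper_eq_linear_span']
  simp

lemma lie_mem_der (x y : L) : ⁅x, y⁆ ∈ der K L := by
  rw [der_eq_span]; exact Submodule.subset_span ⟨x, y, rfl⟩

lemma mem_ctr2 {x : L} : x ∈ ctr2 K L ↔ ∀ y, ⁅x, y⁆ ∈ ctr K L := Iff.rfl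

lemma mem_relCent {x y : L} : y ∈ relCent K x ↔ ⁅x, y⁆ ∈ ctr K L := Iff.rfl

lemma lie_mem_ctr_comm {x y : L} : ⁅x, y⁆ ∈ ctr K L ↔ ⁅y, x⁆ ∈ ctr K L := by
  rw [← lie_skew, neg_mem_iff]

lemma ctr_le_ctr2 : ctr K L ≤ ctr2 K L := fun x hx y => by
  rw [mem_ctr.1 hx y]; exact zero_mem _

lemma ctr2_le_relCent (x : L) : ctr2 K L ≤ relCent K x := fun _ hy =>
  lie_mem_ctr_comm.1 (hy x)

/-- The second center commutes with the derived subalgebra. -/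
lemma lie_eq_zero_of_mem_ctr2 {x y : L} (hx : x ∈ ctr2 K L) (hy : y ∈ der K L) :
    ⁅x, y⁆ = 0 := by
  rw [der_eq_span] at hy
  induction hy using Submodule.span_induction with
  | mem z hz =>
    obtain ⟨a, b, rfl⟩ := hz
    rw [leibniz_lie, mem_ctr.1 (hx a), mem_ctr'.1 (hx b), add_zero]
  | zero => simp
  | add a b _ _ ha hb => rw [lie_add, ha, hb, add_zero]
  | smul c a _ ha => rw [lie_smul, ha, smul_zero]

lemma der_le_ctr2_of_lie_lie_lie (h : ∀ x y z w : L, ⁅x, ⁅y, ⁅z, w⁆⁆⁆ = 0) :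
    der K L ≤ ctr2 K L := by
  rw [der_eq_span, Submodule.span_le]
  rintro _ ⟨a, b, rfl⟩ y
  rw [mem_ctr']
  intro z
  rw [← lie_skew ⁅a, b⁆ y, lie_neg, h, neg_zero]

lemma finrank_map_ad_add_eq [FiniteDimensional K L] (x : L) (S : Submodule K L) :
    finrank K (S.map (ad K L x)) + finrank K (S ⊓ LinearMap.ker (ad K L x) : Submodule K L)
      = finrank K S := by
  have h := LinearMap.finrank_range_add_finrank_ker ((ad K L x).domRestrict S)
  rw [LinearMap.range_domRestrict, LinearMap.ker_domRestrict] at h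
  rw [← h, inf_comm, ← Submodule.finrank_map_subtype_eq S, Submodule.map_comap_subtype, inf_comm]

lemma mem_ker_ad {x y : L} : y ∈ LinearMap.ker (ad K L x) ↔ ⁅x, y⁆ = 0 := Iff.rfl

end Basic

namespace IsBreadthThree

variable {K L : Type*} [Field K] [LieRing L] [LieAlgebra K L] {n : ℕ}

lemma der_le_ctr2 (h : IsBreadthThree K L n) : der K L ≤ ctr2 K L :=
  der_le_ctr2_of_lie_lie_lie h.lie_lie_lie

lemma rank_eq [FiniteDimensional K L] (h : IsBreadthThree K L n) {x : L} (hx : x ∉ ctr K L) :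
    n + finrank K (LinearMap.ker (ad K L x)) = finrank K L := by
  rw [← h.rank x hx, LinearMap.finrank_range_add_finrank_ker]

/-- For noncentral `x`, the image of `relCent x` under `ad x` has dimension `n` minus the
codimension of `relCent x`. -/
lemma finrank_map_relCent [FiniteDimensional K L] (h : IsBreadthThree K L n) {x : L}
    (hx : x ∉ ctr K L) :
    finrank K ((relCent K x).map (ad K L x)) + finrank K L = n + finrank K (relCent K x) := by
  have h1 := finrank_map_ad_add_eq x (relCent K x)
  have h2 := h.rank_eq hx
  have h3 : relCent K x ⊓ LinearMap.ker (ad K L x) = LinearMap.ker (ad K L x) := by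
    refine inf_eq_right.2 fun y hy => ?_
    rw [mem_relCent, mem_ker_ad.1 hy]
    exact zero_mem _
  rw [h3] at h1
  omega

lemma finrank_range_comp_le [FiniteDimensional K L] (x a : L) :
    finrank K (LinearMap.range (ad K L x ∘ₗ ad K L a)) + finrank K (relCent K a)
      ≤ finrank K L := by
  rw [← LinearMap.finrank_range_add_finrank_ker (ad K L x ∘ₗ ad K L a)]
  gcongr
  refine Submodule.finrank_mono fun y hy => ?_
  rw [LinearMap.mem_ker]
  exact mem_ctr'.1 (mem_relCent.1 hy) x

/-- If `x` and `a` do not commute modulo the center, the codimensions of their centralizers modulo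
the center add up to `n`, and `ad x` maps the derived subalgebra onto a space whose dimension
is the codimension of `relCent a`. The reason is the identity
`⁅⁅a, x⁆, g⁆ = ⁅a, ⁅x, g⁆⁆ - ⁅x, ⁅a, g⁆⁆`, which bounds the rank `n` of `ad ⁅a, x⁆`. -/
lemma codim_add_codim [FiniteDimensional K L] (h : IsBreadthThree K L n) {x a : L}
    (hxa : ⁅a, x⁆ ∉ ctr K L) :
    2 * finrank K L = n + finrank K (relCent K x) + finrank K (relCent K a) ∧
    finrank K ((der K L).map (ad K L x)) + finrank K (relCent K a) = finrank K L := by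
  have hx : x ∉ ctr K L := fun hx => hxa (by rw [mem_ctr'.1 hx]; exact zero_mem _)
  have ha : a ∉ ctr K L := fun ha => hxa (by rw [mem_ctr.1 ha]; exact zero_mem _)
  have key : LinearMap.range (ad K L ⁅a, x⁆) ≤
      LinearMap.range (ad K L a ∘ₗ ad K L x) ⊔ LinearMap.range (ad K L x ∘ₗ ad K L a) := by
    rintro _ ⟨g, rfl⟩
    rw [ad_apply, lie_lie]
    exact sub_mem (Submodule.mem_sup_left ⟨g, rfl⟩) (Submodule.mem_sup_right ⟨g, rfl⟩)
  have h0 := (Submodule.finrank_mono key).trans (Submodule.finrank_add_le_finrank_add_finrank _ _)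
  rw [h.rank _ hxa] at h0
  have sub (u v : L) : finrank K (LinearMap.range (ad K L u ∘ₗ ad K L v)) ≤
      finrank K ((der K L).map (ad K L u)) := by
    refine Submodule.finrank_mono ?_
    rintro _ ⟨g, rfl⟩
    exact ⟨⁅v, g⁆, lie_mem_der v g, rfl⟩
  have sub' (u : L) : finrank K ((der K L).map (ad K L u)) ≤
      finrank K ((relCent K u).map (ad K L u)) :=
    Submodule.finrank_mono (Submodule.map_mono (h.der_le_ctr2.trans (ctr2_le_relCent u)))
  have e1 := h.finrank_map_relCent hx
  have e2 := h.finrank_map_relCent ha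
  have e3 := finrank_range_comp_le (K := K) x a
  have e4 := finrank_range_comp_le (K := K) a x
  have e5 := sub x a
  have e6 := sub a x
  have e7 := sub' x
  have e8 := sub' a
  omega

/-- Outside the second center, the rank of `ad x` modulo the center and the dimension of
`⁅x, [L, L]⁆` are both half of the breadth. It suffices to apply `codim_add_codim` to the pairs
from `x`, `a` and `x + a`, which do not commute modulo the center. -/
lemma two_mul_finrank_map_der [FiniteDimensional K L] (h : IsBreadthThree K L n) {x : L}
    (hx : x ∉ ctr2 K L) :
    n = 2 * (finrank K ((der K L).map (ad K L x))) ∧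
    finrank K (relCent K x) + finrank K ((der K L).map (ad K L x)) = finrank K L := by
  obtain ⟨a, ha⟩ : ∃ a, ⁅x, a⁆ ∉ ctr K L := by simpa [mem_ctr2] using hx
  have h1 := h.codim_add_codim ha
  have h2 := h.codim_add_codim (fun h => ha (lie_mem_ctr_comm.1 h))
  have h3 := h.codim_add_codim (a := x) (x := x + a) (by rwa [lie_add, lie_self, zero_add])
  have h4 := h.codim_add_codim (a := a) (x := x + a)
    (by rw [lie_add, lie_self, add_zero]; exact fun h => ha (lie_mem_ctr_comm.1 h))
  omega

section Half

variable {m : ℕ} [FiniteDimensional K L] (h : IsBreadthThree K L (2 * m))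
include h

lemma finrank_relCent {x : L} (hx : x ∉ ctr2 K L) :
    finrank K (relCent K x) + m = finrank K L := by
  have := h.two_mul_finrank_map_der hx; omega

lemma finrank_map_der {x : L} (hx : x ∉ ctr2 K L) :
    finrank K ((der K L).map (ad K L x)) = m := by
  have := h.two_mul_finrank_map_der hx; omega

/-- For `x` outside the second center, `⁅x, y⁆` is central only if it is already of the form
`⁅x, g⁆` with `g` in the derived subalgebra. -/
lemma map_relCent {x : L} (hx : x ∉ ctr2 K L) :
    (relCent K x).map (ad K L x) = (der K L).map (ad K L x) := by
  refine (Submodule.eq_of_le_of_finrank_le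
    (Submodule.map_mono (h.der_le_ctr2.trans (ctr2_le_relCent x))) ?_).symm
  have h1 := h.finrank_map_relCent fun h => hx (ctr_le_ctr2 h)
  have h2 := h.finrank_relCent hx
  have h3 := h.finrank_map_der hx
  omega

lemma finrank_map_ctr2 {x : L} (hx : x ∉ ctr2 K L) :
    finrank K ((ctr2 K L).map (ad K L x)) = m := by
  rw [← h.finrank_map_der hx]
  refine le_antisymm (Submodule.finrank_mono ?_)
    (Submodule.finrank_mono (Submodule.map_mono h.der_le_ctr2))
  rw [← h.map_relCent hx]
  exact Submodule.map_mono (ctr2_le_relCent x)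

end Half

end IsBreadthThree

/-! ### Counting commuting pairs -/

section Count

variable {K L : Type*} [Field K] [LieRing L] [LieAlgebra K L]

/-- Double counting of the pairs `(x, w)` with `w ∈ S` and `⁅x, w⁆ = 0`. -/
lemma sum_card_inf_ker_ad [Fintype L] (S : Submodule K L) [DecidablePred (· ∈ S)] :
    ∑ x : L, Nat.card ↥(S ⊓ LinearMap.ker (ad K L x)) =
      ∑ w : L, if w ∈ S then Nat.card ↥(LinearMap.ker (ad K L w)) else 0 := by
  rw [← Finset.sum_filter, ← Finset.sum_subtype_eq_sum_filter, Finset.subtype_univ,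
    ← Nat.card_sigma, ← Nat.card_sigma]
  refine Nat.card_congr
    { toFun := fun p => ⟨⟨p.2.1, p.2.2.1⟩, ⟨p.1, ?_⟩⟩
      invFun := fun p => ⟨p.2.1, ⟨p.1.1, p.1.2, ?_⟩⟩
      left_inv := fun p => rfl
      right_inv := fun p => rfl }
  · have h : ⁅p.1, (p.2 : L)⁆ = 0 := p.2.2.2
    exact mem_ker_ad.2 (by rw [← lie_skew, h, neg_zero])
  · have h : ⁅(p.1 : L), (p.2 : L)⁆ = 0 := p.2.2
    exact mem_ker_ad.2 (by rw [← lie_skew, h, neg_zero])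

lemma card_submodule [FiniteDimensional K L] (S : Submodule K L) :
    Nat.card S = Nat.card K ^ finrank K S := Module.natCard_eq_pow_finrank

lemma sum_ite_mem [Finite K] [FiniteDimensional K L] [Fintype L] (S : Submodule K L)
    [DecidablePred (· ∈ S)] (A : ℕ) :
    ∑ x : L, (if x ∈ S then A else 0) = Nat.card K ^ finrank K S * A := by
  rw [← Finset.sum_filter, Finset.sum_const, ← card_submodule, smul_eq_mul,
    Nat.card_eq_fintype_card, Fintype.card_subtype]

end Count

/-- The inequality that bounds the dimension `z + w` of the second center: each of the three powers
on the left is at most a third of the right-hand side. -/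
lemma exponent_bound {q m z w t : ℕ} (hq : 3 ≤ q) (hm : 1 ≤ m) (hw : m + 1 ≤ w) :
    q ^ (z + w) * q ^ (z + w - m) + (q ^ (z + w) * q ^ (z + w + t) +
      q ^ z * q ^ (z + w + 2 * m + t)) ≤ q ^ (z + w + 2 * m + t) * q ^ (z + w - m) := by
  obtain ⟨s, rfl⟩ : ∃ s, w = m + 1 + s := ⟨w - (m + 1), by omega⟩
  obtain ⟨r, rfl⟩ : ∃ r, m = r + 1 := ⟨m - 1, by omega⟩
  have h0 : 0 < q := by omega
  simp only [← pow_add]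
  have e (k : ℕ) (hk : k ≤ 2 * z + 3 * r + 4 + 2 * s + t) :
      q ^ k ≤ q ^ (2 * z + 3 * r + 4 + 2 * s + t) := Nat.pow_le_pow_right h0 hk
  have h1 : 3 * q ^ (2 * z + 3 * r + 4 + 2 * s + t) ≤
      q ^ (2 * z + 3 * r + 4 + 2 * s + t + 1) := by
    rw [pow_succ, mul_comm]; exact Nat.mul_le_mul_left _ hq
  have e1 := e (z + (r + 1 + 1 + s) + (z + (r + 1 + 1 + s) - (r + 1))) (by omega)
  have e2 := e (z + (r + 1 + 1 + s) + (z + (r + 1 + 1 + s) + t)) (by omega)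
  have e3 := e (z + (z + (r + 1 + 1 + s) + 2 * (r + 1) + t)) (by omega)
  have e4 : z + (r + 1 + 1 + s) + 2 * (r + 1) + t + (z + (r + 1 + 1 + s) - (r + 1)) =
      2 * z + 3 * r + 4 + 2 * s + t + 1 := by omega
  rw [e4]
  omega

/-- After division by `q ^ (2 * z + m)`, the equation reads `(q ^ m - 1) * (q ^ t - 1) = 0`. -/
lemma exponent_eq {q m z t : ℕ} (hq : 3 ≤ q) (hm : 1 ≤ m)
    (h : q ^ (z + m) * q ^ (z + m) + q ^ z * q ^ (z + m + t) =
      q ^ (z + m) * q ^ (z + m + t) + q ^ (z + m) * q ^ z) : t = 0 := by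
  have h0 : 0 < q := by omega
  have h1 : q ^ (2 * z + m) * (q ^ m + q ^ t) = q ^ (2 * z + m) * (q ^ m * q ^ t + 1) := by
    simp only [pow_add, pow_mul] at h ⊢
    linear_combination h
  have h2 := Nat.eq_of_mul_eq_mul_left (pow_pos h0 _) h1
  by_contra ht
  have h3 : 3 ≤ q ^ t := hq.trans (Nat.le_self_pow ht q)
  have h4 : 3 ≤ q ^ m := hq.trans (Nat.le_self_pow (by omega) q)
  nlinarith

namespace IsBreadthThree

variable {K L : Type*} [Field K] [LieRing L] [LieAlgebra K L] {m : ℕ}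

/-- A noncentral element of the derived subalgebra. -/
lemma exists_mem_der (h : IsBreadthThree K L (2 * m)) : ∃ w ∈ der K L, w ∉ ctr K L := by
  obtain ⟨x, hx⟩ := h.exists_notMem
  obtain ⟨a, ha⟩ : ∃ a, ⁅x, a⁆ ∉ ctr K L := by simpa [mem_ctr2] using hx
  exact ⟨_, lie_mem_der _ _, ha⟩

lemma lie_eq_zero_of_mem_der (h : IsBreadthThree K L (2 * m)) {x y : L} (hx : x ∈ der K L) 
    (hy : y ∈ der K L) : ⁅x, y⁆ = 0 :=
  lie_eq_zero_of_mem_ctr2 (h.der_le_ctr2 hx) hy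

variable [FiniteDimensional K L] (h : IsBreadthThree K L (2 * m))
include h

lemma finrank_ker {x : L} (hx : x ∉ ctr K L) :
    2 * m + finrank K (LinearMap.ker (ad K L x)) = finrank K L := h.rank_eq hx

lemma finrank_ctr2_le : finrank K (ctr2 K L) + 2 * m ≤ finrank K L := by
  obtain ⟨w, hw, hw'⟩ := h.exists_mem_der
  have h1 := h.finrank_ker hw'
  have h2 : ctr2 K L ≤ LinearMap.ker (ad K L w) := fun y hy => by
    rw [mem_ker_ad, ← lie_skew, lie_eq_zero_of_mem_ctr2 hy hw, neg_zero]
  have h3 := Submodule.finrank_mono h2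
  omega

lemma le_finrank_der : finrank K (ctr K L) + m ≤ finrank K (der K L) := by
  obtain ⟨x, hx⟩ := h.exists_notMem
  have h1 := finrank_map_ad_add_eq x (der K L)
  rw [h.finrank_map_der hx] at h1
  have h2 : ctr K L ≤ der K L ⊓ LinearMap.ker (ad K L x) :=
    le_inf h.stem fun y hy => mem_ctr'.1 hy x
  have h3 := Submodule.finrank_mono h2
  omega

/-- The number of commuting pairs in `ctr2 K L × L`, from the centralizers of the elements of the
second center. -/
lemma sum_card_ker [Finite K] [Fintype L] [DecidablePred (· ∈ ctr2 K L)] :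
    (∑ w : L, if w ∈ ctr2 K L then Nat.card ↥(LinearMap.ker (ad K L w)) else 0) +
      Nat.card K ^ finrank K (ctr K L) * Nat.card K ^ (finrank K L - 2 * m) =
    Nat.card K ^ finrank K (ctr2 K L) * Nat.card K ^ (finrank K L - 2 * m) +
      Nat.card K ^ finrank K (ctr K L) * Nat.card K ^ finrank K L := by
  classical
  simp only [← sum_ite_mem, ← Finset.sum_add_distrib]
  refine Finset.sum_congr rfl fun w _ => ?_
  by_cases hw : w ∈ ctr K L
  · have h1 : LinearMap.ker (ad K L w) = ⊤ := eq_top_iff.2 fun y _ => mem_ctr.1 hw y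
    have h2 : Nat.card (LinearMap.ker (ad K L w)) = Nat.card K ^ finrank K L := by
      rw [card_submodule, h1, finrank_top]
    rw [if_pos (ctr_le_ctr2 hw), if_pos hw, if_pos (ctr_le_ctr2 hw), if_pos hw, h2, add_comm]
  · have h2 : Nat.card (LinearMap.ker (ad K L w)) = Nat.card K ^ (finrank K L - 2 * m) := by
      rw [card_submodule, ← h.finrank_ker hw, Nat.add_sub_cancel_left]
    rw [if_neg hw, if_neg hw, h2]

lemma card_ctr2_inf_ker {x : L} (hx : x ∉ ctr2 K L) :
    Nat.card ↥(ctr2 K L ⊓ LinearMap.ker (ad K L x)) =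
      Nat.card K ^ (finrank K (ctr2 K L) - m) := by
  have h1 := finrank_map_ad_add_eq x (ctr2 K L)
  rw [h.finrank_map_ctr2 hx] at h1
  rw [card_submodule, ← h1, Nat.add_sub_cancel_left]

variable [Finite K] (hq : 3 ≤ Nat.card K) (hm : 1 ≤ m)
include hq hm

/-- The second center exceeds the center by `m` dimensions: a larger one would have too few
commuting pairs. -/
lemma finrank_ctr2 : finrank K (ctr2 K L) = finrank K (ctr K L) + m := by
  classical
  have : Finite L := Module.finite_of_finite K
  have := Fintype.ofFinite L
  have h1 := h.sum_card_ker
  rw [← sum_card_inf_ker_ad] at h1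
  have h2 := h.finrank_ctr2_le
  have h3 := h.le_finrank_der.trans (Submodule.finrank_mono h.der_le_ctr2)
  -- Lower bound for the number of commuting pairs, from the `x` outside the second center.
  have h4 : Nat.card K ^ finrank K L * Nat.card K ^ (finrank K (ctr2 K L) - m) ≤
      ∑ x : L, Nat.card ↥(ctr2 K L ⊓ LinearMap.ker (ad K L x)) +
      Nat.card K ^ finrank K (ctr2 K L) * Nat.card K ^ (finrank K (ctr2 K L) - m) := by
    rw [← sum_ite_mem, ← finrank_top K L, ← sum_ite_mem, ← Finset.sum_add_distrib]
    refine Finset.sum_le_sum fun x _ => ?_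
    by_cases hx : x ∈ ctr2 K L
    · simp [hx]
    · rw [h.card_ctr2_inf_ker hx, if_pos Submodule.mem_top]
      exact Nat.le_add_right _ _
  by_contra hne
  obtain ⟨w, hw⟩ : ∃ w, finrank K (ctr2 K L) = finrank K (ctr K L) + w :=
    ⟨finrank K (ctr2 K L) - finrank K (ctr K L), by omega⟩
  obtain ⟨t, ht⟩ : ∃ t, finrank K L = finrank K (ctr K L) + w + 2 * m + t :=
    ⟨finrank K L - (finrank K (ctr K L) + w + 2 * m), by omega⟩
  have h5 := exponent_bound (z := finrank K (ctr K L)) (t := t) hq hm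
    (show m + 1 ≤ w by omega)
  have h6 : 0 < Nat.card K ^ finrank K (ctr K L) * Nat.card K ^ (finrank K L - 2 * m) := by
    have : 0 < Nat.card K := by omega
    positivity
  have h7 : finrank K L - 2 * m = finrank K (ctr K L) + w + t := by omega
  rw [h7] at h1 h6
  rw [hw, ht] at h1 h4
  omega

lemma ctr2_eq_der : ctr2 K L = der K L := by
  refine (Submodule.eq_of_le_of_finrank_le h.der_le_ctr2 ?_).symm
  rw [h.finrank_ctr2 hq hm]
  exact h.le_finrank_der

lemma finrank_der : finrank K (der K L) = finrank K (ctr K L) + m := by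
  rw [← h.ctr2_eq_der hq hm, h.finrank_ctr2 hq hm]

/-- Now that the second center is abelian, the number of commuting pairs is known exactly from both
sides, and the dimension of `L` is the only solution. -/
lemma finrank_eq : finrank K L = finrank K (ctr K L) + 3 * m := by
  classical
  have : Finite L := Module.finite_of_finite K
  have := Fintype.ofFinite L
  have h1 := h.sum_card_ker
  rw [← sum_card_inf_ker_ad] at h1
  have h2 := h.finrank_ctr2_le
  have h3 := h.finrank_ctr2 hq hm
  have h4 : ∑ x : L, Nat.card ↥(ctr2 K L ⊓ LinearMap.ker (ad K L x)) +
      Nat.card K ^ finrank K (ctr2 K L) * Nat.card K ^ finrank K (ctr K L) =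
      Nat.card K ^ finrank K L * Nat.card K ^ finrank K (ctr K L) +
      Nat.card K ^ finrank K (ctr2 K L) * Nat.card K ^ finrank K (ctr2 K L) := by
    rw [← sum_ite_mem, ← finrank_top K L, ← sum_ite_mem, ← sum_ite_mem,
      ← Finset.sum_add_distrib, ← Finset.sum_add_distrib]
    refine Finset.sum_congr rfl fun x _ => ?_
    by_cases hx : x ∈ ctr2 K L
    · have h5 : ctr2 K L ⊓ LinearMap.ker (ad K L x) = ctr2 K L :=
        inf_eq_left.2 fun y hy =>
          lie_eq_zero_of_mem_ctr2 hx (h.ctr2_eq_der hq hm ▸ hy)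
      have h6 : Nat.card ↥(ctr2 K L ⊓ LinearMap.ker (ad K L x)) =
          Nat.card K ^ finrank K (ctr2 K L) := by rw [card_submodule, h5]
      rw [h6, if_pos hx, if_pos hx, if_pos Submodule.mem_top, add_comm]
    · rw [h.card_ctr2_inf_ker hx, if_neg hx, if_neg hx, if_pos Submodule.mem_top, h3,
        Nat.add_sub_cancel]
  obtain ⟨t, ht⟩ : ∃ t, finrank K L = finrank K (ctr K L) + m + 2 * m + t :=
    ⟨finrank K L - (finrank K (ctr K L) + m + 2 * m), by omega⟩
  have h7 : finrank K L - 2 * m = finrank K (ctr K L) + m + t := by omega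
  rw [h7] at h1
  rw [h3] at h1 h4
  have := exponent_eq (z := finrank K (ctr K L)) (t := t) hq hm (by
    rw [mul_comm (Nat.card K ^ finrank K (ctr K L)) (Nat.card K ^ finrank K L)] at h1
    omega)
  omega

/-- Outside the derived subalgebra, an element commutes only with the central elements of the
derived subalgebra. -/
lemma mem_ctr_of_lie_eq_zero {x y : L} (hx : x ∉ der K L) (hy : y ∈ der K L)
    (hxy : ⁅x, y⁆ = 0) : y ∈ ctr K L := by
  have h1 := finrank_map_ad_add_eq x (der K L)
  rw [h.finrank_map_der (h.ctr2_eq_der hq hm ▸ hx), h.finrank_der hq hm] at h1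
  have h2 : ctr K L ≤ der K L ⊓ LinearMap.ker (ad K L x) :=
    le_inf h.stem fun y hy => mem_ctr'.1 hy x
  rw [Submodule.eq_of_le_of_finrank_le h2 (by omega)]
  exact ⟨hy, hxy⟩

/-- The centralizer of a noncentral element of the derived subalgebra is the derived subalgebra. -/
lemma mem_der_of_lie_eq_zero {x w : L} (hw : w ∈ der K L) (hw' : w ∉ ctr K L)
    (hxw : ⁅x, w⁆ = 0) : x ∈ der K L := by
  by_contra hx
  exact hw' (h.mem_ctr_of_lie_eq_zero hq hm hx hw hxw)

/-- The centralizers modulo the center of elements outside the derived subalgebra are abelian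
modulo the center. -/
lemma lie_mem_ctr {x y z : L} (hx : x ∉ der K L) (hy : ⁅x, y⁆ ∈ ctr K L)
    (hz : ⁅x, z⁆ ∈ ctr K L) : ⁅y, z⁆ ∈ ctr K L := by
  refine h.mem_ctr_of_lie_eq_zero hq hm hx (lie_mem_der _ _) ?_
  rw [leibniz_lie, mem_ctr.1 hy, mem_ctr'.1 hz, add_zero]

lemma exists_mem_der_lie_eq {x y : L} (hx : x ∉ der K L) (hy : ⁅x, y⁆ ∈ ctr K L) :
    ∃ g ∈ der K L, ⁅x, y⁆ = ⁅x, g⁆ := by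
  have h1 : ⁅x, y⁆ ∈ (relCent K x).map (ad K L x) := ⟨y, hy, rfl⟩
  rw [h.map_relCent (h.ctr2_eq_der hq hm ▸ hx)] at h1
  obtain ⟨g, hg, hg'⟩ := h1
  exact ⟨g, hg, hg'.symm⟩

end IsBreadthThree

/-! ### The coordinate field -/

section Coordinates

section FieldOfMul

variable {K W F : Type*} [Field K] [Finite K] [AddCommGroup W] [Module K W]
  [FiniteDimensional K W] [Field F] [Algebra K F]

/-- A commutative, associative and unital bilinear multiplication without zero divisors on a
vector space over a finite field is, up to a linear isomorphism, the multiplication of any given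
extension field of the right degree. -/
lemma exists_equiv_of_mul (mul : W →ₗ[K] W →ₗ[K] W) (one : W)
    (comm : ∀ a b, mul a b = mul b a) (assoc : ∀ a b c, mul (mul a b) c = mul a (mul b c))
    (one_mul : ∀ a, mul one a = a) (nzd : ∀ a b, mul a b = 0 → a = 0 ∨ b = 0)
    (hW : 0 < finrank K W) (hF : finrank K F = finrank K W) :
    ∃ e : F ≃ₗ[K] W, ∀ a b, e (a * b) = mul (e a) (e b) := by
  let instRing : CommRing W :=
    { ‹AddCommGroup W› with
      mul := fun a b => mul a b
      one := one
      mul_assoc := assoc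
      mul_comm := comm
      one_mul := one_mul
      mul_one := fun a => (comm a one).trans (one_mul a)
      left_distrib := fun a b c => map_add (mul a) b c
      right_distrib := fun a b c => LinearMap.map_add₂ mul a b c
      zero_mul := fun a => LinearMap.map_zero₂ mul a
      mul_zero := fun a => map_zero (mul a) }
  let instAlg : Algebra K W := Algebra.ofModule
    (fun r x y => LinearMap.map_smul₂ mul r x y) (fun r x y => map_smul (mul x) r y)
  have : Nontrivial W := Module.nontrivial_of_finrank_pos hW
  have : NoZeroDivisors W := ⟨fun {a b} h => nzd a b h⟩
  have : IsDomain W := NoZeroDivisors.to_isDomain W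
  have : Finite W := Module.finite_of_finite K
  let instField : Field W := (Finite.isField_of_domain W).toField
  obtain ⟨p, hp⟩ := CharP.exists K
  have : Fact p.Prime := ⟨CharP.char_is_prime K p⟩
  have : NeZero (finrank K W) := ⟨hW.ne'⟩
  let e : F ≃ₐ[K] W := (FiniteField.algEquivExtension K p (finrank K W) F hF).trans
    (FiniteField.algEquivExtension K p (finrank K W) W rfl).symm
  exact ⟨e.toLinearEquiv, fun a b => map_mul e a b⟩

end FieldOfMul

variable {K L F : Type*} [Field K] [LieRing L] [LieAlgebra K L] [Field F] [Algebra K F]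

/-- Coordinates on a Lie algebra `L` of class three modulo its center: linear maps `s₁` and `s₂`
identify `L / [L, L]` with `F × F`, and `π` identifies `[L, L]` modulo the center with `F`, in
such a way that the bracket becomes the determinant form over `F`. -/
structure IsCoordinates (s₁ s₂ : F →ₗ[K] L) (π : L →ₗ[K] F) : Prop where
  lie_left : ∀ a b, ⁅s₁ a, s₁ b⁆ ∈ ctr K L
  lie_right : ∀ a b, ⁅s₂ a, s₂ b⁆ ∈ ctr K L
  map_lie : ∀ a b, π ⁅s₁ a, s₂ b⁆ = a * b
  map_eq_zero : ∀ y ∈ der K L, π y = 0 ↔ y ∈ ctr K L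
  exists_sub : ∀ x, ∃ a b, x - s₁ a - s₂ b ∈ der K L

namespace IsBreadthThree

variable {m : ℕ} [FiniteDimensional K L] (h : IsBreadthThree K L (2 * m)) [Finite K]
  (hq : 3 ≤ Nat.card K) (hm : 1 ≤ m)
include h hq hm

/-- The quotient of the derived subalgebra by the center is identified with `F` as a vector
space. -/
lemma exists_proj (hF : finrank K F = m) :
    ∃ π : L →ₗ[K] F, ∀ y ∈ der K L, π y = 0 ↔ y ∈ ctr K L := by
  have : FiniteDimensional K F := Module.finite_of_finrank_pos (by omega)
  have h1 : finrank K ((der K L).map (ctr K L).mkQ) = finrank K F := by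
    have h2 := LinearMap.finrank_range_add_finrank_ker ((ctr K L).mkQ.domRestrict (der K L))
    rw [LinearMap.range_domRestrict, LinearMap.ker_domRestrict, Submodule.ker_mkQ,
      ← Submodule.finrank_map_subtype_eq, Submodule.map_comap_subtype,
      inf_eq_right.2 h.stem] at h2
    have := h.finrank_der hq hm
    omega
  obtain ⟨p, hp⟩ := LinearMap.exists_leftInverse_of_injective
    ((der K L).map (ctr K L).mkQ).subtype (Submodule.ker_subtype _)
  let e := LinearEquiv.ofFinrankEq _ F h1
  refine ⟨e.toLinearMap ∘ₗ p ∘ₗ (ctr K L).mkQ, fun y hy => ?_⟩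
  have h3 : p ((ctr K L).mkQ y) = ⟨(ctr K L).mkQ y, Submodule.mem_map_of_mem hy⟩ :=
    LinearMap.congr_fun hp ⟨(ctr K L).mkQ y, Submodule.mem_map_of_mem hy⟩
  rw [LinearMap.comp_apply, LinearMap.comp_apply, h3, LinearEquiv.coe_coe,
    LinearEquiv.map_eq_zero_iff, Submodule.mk_eq_zero, Submodule.mkQ_apply,
    Submodule.Quotient.mk_eq_zero]

/-- A linear parametrization of `relCent e₁` modulo the derived subalgebra by the brackets
with `e₂`. -/
lemma exists_section {π : L →ₗ[K] F} (hF : finrank K F = m)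
    (hπ : ∀ y ∈ der K L, π y = 0 ↔ y ∈ ctr K L) {e₁ e₂ : L} (he : ⁅e₁, e₂⁆ ∉ ctr K L) :
    ∃ p : F →ₗ[K] L, ∀ a, ⁅e₁, p a⁆ ∈ ctr K L ∧ π ⁅p a, e₂⁆ = a := by
  have : FiniteDimensional K F := Module.finite_of_finrank_pos (by omega)
  have he₁ : e₁ ∉ ctr2 K L := fun h' => he (h' e₂)
  let f : relCent K e₁ →ₗ[K] F := π ∘ₗ (-ad K L e₂) ∘ₗ (relCent K e₁).subtype
  have hf (x : relCent K e₁) : f x = π ⁅(x : L), e₂⁆ := by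
    change π (-⁅e₂, (x : L)⁆) = _
    rw [lie_skew]
  have hker : LinearMap.ker f = (der K L).comap (relCent K e₁).subtype := by
    ext x
    rw [LinearMap.mem_ker, hf, hπ _ (lie_mem_der _ _), Submodule.mem_comap,
      Submodule.subtype_apply]
    refine ⟨fun hx => ?_, fun hx => h.der_le_ctr2 hx e₂⟩
    by_contra hx'
    exact he (h.lie_mem_ctr hq hm hx' (lie_mem_ctr_comm.1 x.2) hx)
  have hsurj : LinearMap.range f = ⊤ := by
    apply Submodule.eq_top_of_finrank_eq
    have h2 := LinearMap.finrank_range_add_finrank_ker f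
    rw [hker, ← Submodule.finrank_map_subtype_eq (relCent K e₁) (Submodule.comap _ _),
      Submodule.map_comap_subtype,
      inf_eq_right.2 (h.der_le_ctr2.trans (ctr2_le_relCent e₁)), h.finrank_der hq hm] at h2
    have h3 := h.finrank_relCent he₁
    have h4 := h.finrank_eq hq hm
    omega
  obtain ⟨g, hg⟩ := LinearMap.exists_rightInverse_of_surjective f hsurj
  refine ⟨(relCent K e₁).subtype ∘ₗ g, fun a => ⟨(g a).2, ?_⟩⟩
  have := LinearMap.congr_fun hg a
  rw [LinearMap.comp_apply, hf] at this
  exact this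

/-- The centralizers modulo the center partition `L / [L, L]`, and the bracket between two of
them is a multiplication; that the remaining ones are abelian makes it commutative and
associative, so that it is the multiplication of the field `F`. -/
theorem exists_isCoordinates (hF : finrank K F = m) :
    ∃ (s₁ s₂ : F →ₗ[K] L) (π : L →ₗ[K] F), IsCoordinates s₁ s₂ π := by
  have : FiniteDimensional K F := Module.finite_of_finrank_pos (by omega)
  obtain ⟨π, hπ⟩ := h.exists_proj (F := F) hq hm hF
  obtain ⟨e₁, he₁⟩ := h.exists_notMem
  obtain ⟨e₂, he⟩ : ∃ a, ⁅e₁, a⁆ ∉ ctr K L := by simpa [mem_ctr2] using he₁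
  have hω (x y : L) : π ⁅x, y⁆ = 0 ↔ ⁅x, y⁆ ∈ ctr K L := hπ _ (lie_mem_der x y)
  have hω' (x y : L) : π ⁅y, x⁆ = -π ⁅x, y⁆ := by rw [← map_neg, lie_skew]
  have hder {x : L} (hx : x ∈ der K L) (y : L) : π ⁅x, y⁆ = 0 :=
    (hω x y).2 (h.der_le_ctr2 hx y)
  have habel {x y z : L} (hx : x ∉ der K L) (hy : π ⁅x, y⁆ = 0) (hz : π ⁅x, z⁆ = 0) :
      π ⁅y, z⁆ = 0 :=
    (hω y z).2 (h.lie_mem_ctr hq hm hx ((hω x y).1 hy) ((hω x z).1 hz))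
  have he0 : π ⁅e₁, e₂⁆ ≠ 0 := fun h0 => he ((hω _ _).1 h0)
  have hmem {x : L} (h1 : π ⁅e₁, x⁆ = 0) (h2 : π ⁅x, e₂⁆ = 0) : x ∈ der K L := by
    by_contra hx
    exact he0 (habel hx (by rw [hω', h1, neg_zero]) h2)
  have he1' : e₁ ∉ der K L := fun hx => he0 (hder hx e₂)
  have he2' : e₂ ∉ der K L := fun hx => he0 (by rw [hω', hder hx e₁, neg_zero])
  obtain ⟨p, hp⟩ := h.exists_section hq hm hF hπ he
  -- The second parametrization `r` is normalized by brackets with `e₁` from the left.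
  obtain ⟨p', hp'⟩ := h.exists_section hq hm hF hπ (e₁ := e₂) (e₂ := e₁)
    fun h0 => he (lie_mem_ctr_comm.1 h0)
  obtain ⟨r, hr⟩ : ∃ r : F →ₗ[K] L, ∀ b, π ⁅e₂, r b⁆ = 0 ∧ π ⁅e₁, r b⁆ = b := by
    refine ⟨-p', fun b => ⟨?_, ?_⟩⟩
    · rw [LinearMap.neg_apply, lie_neg, map_neg, (hω _ _).2 (hp' b).1, neg_zero]
    · rw [LinearMap.neg_apply, lie_neg, lie_skew, (hp' b).2]
  have hp1 (a : F) : π ⁅e₁, p a⁆ = 0 := (hω _ _).2 (hp a).1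
  have hp2 (a : F) : π ⁅p a, e₂⁆ = a := (hp a).2
  have hr1 (b : F) : π ⁅r b, e₂⁆ = 0 := by rw [hω', (hr b).1, neg_zero]
  have hr2 (b : F) : π ⁅e₁, r b⁆ = b := (hr b).2
  have hpp (a b : F) : π ⁅p a, p b⁆ = 0 := habel he1' (hp1 a) (hp1 b)
  have hrr (a b : F) : π ⁅r a, r b⁆ = 0 := habel he2' (hr a).1 (hr b).1
  let mul : F →ₗ[K] F →ₗ[K] F :=
    ((LieModule.toEnd K L L : L →ₗ[K] L →ₗ[K] L).compl₁₂ p r).compr₂ π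
  have hmul (a b : F) : mul a b = π ⁅p a, r b⁆ := rfl
  -- Modulo the center, the elements `p a + r (mul a s)` commute with `e₁ + r s`, hence with each
  -- other.
  have rel (a b s : F) : mul a (mul b s) = mul b (mul a s) := by
    have h0 : e₁ + r s ∉ der K L := fun hx => he0 (by
      rw [← hder hx e₂, add_lie, map_add, hr1, add_zero])
    have h1 (a : F) : π ⁅e₁ + r s, p a + r (mul a s)⁆ = 0 := by
      rw [add_lie, lie_add, lie_add, map_add, map_add, map_add, hp1, hr2, hrr,
        hω' (p a) (r s), ← hmul]
      ring
    have h2 := habel h0 (h1 a) (h1 b)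
    rw [add_lie, lie_add, lie_add, map_add, map_add, map_add, hpp, hrr,
      hω' (p b) (r _), ← hmul, ← hmul] at h2
    linear_combination h2
  have mul_one (a : F) : mul a (π ⁅e₁, e₂⁆) = a := by
    have h1 : r (π ⁅e₁, e₂⁆) - e₂ ∈ der K L := hmem
      (by rw [lie_sub, map_sub, hr2, sub_self]) (by rw [sub_lie, map_sub, hr1, lie_self]; simp)
    have h2 := hder h1 (p a)
    rw [sub_lie, map_sub, sub_eq_zero, hω' (p a), hω' (p a), neg_inj, hp2] at h2
    rw [hmul, h2]
  have comm (a b : F) : mul a b = mul b a := by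
    conv_lhs => rw [← mul_one b]
    rw [rel, mul_one]
  -- A product `mul a b = 0` with `a ≠ 0` puts `e₁` and `r b` into the centralizer of `p a`.
  obtain ⟨e, he⟩ := exists_equiv_of_mul (F := F) mul (π ⁅e₁, e₂⁆) comm
    (fun a b c => by rw [comm, rel, comm c]) (fun a => by rw [comm, mul_one])
    (fun a b hab => by
      by_contra! hne
      have h0 : p a ∉ der K L := fun hx => hne.1 (by rw [← hp2 a, hder hx])
      refine hne.2 ?_
      rw [← hr2 b]
      exact habel h0 (by rw [hω', hp1, neg_zero]) hab) (by omega) rfl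
  refine ⟨p ∘ₗ e, r ∘ₗ e, e.symm ∘ₗ π,
    ⟨fun a b => (hω _ _).1 (hpp _ _), fun a b => (hω _ _).1 (hrr _ _), fun a b => ?_,
      fun y hy => ?_, fun x => ⟨e.symm (π ⁅x, e₂⁆), e.symm (π ⁅e₁, x⁆), ?_⟩⟩⟩
  · exact (LinearEquiv.symm_apply_eq e).2 (he a b).symm
  · rw [← hπ y hy]
    exact LinearEquiv.map_eq_zero_iff e.symm
  · simp only [LinearMap.comp_apply, LinearEquiv.coe_coe, LinearEquiv.apply_symm_apply]
    refine hmem ?_ ?_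
    · rw [lie_sub, lie_sub, map_sub, map_sub, hp1, hr2]; ring
    · rw [sub_lie, sub_lie, map_sub, map_sub, hp2, hr1]; ring

end IsBreadthThree

end Coordinates

/-! ### Normalizing the coordinates -/

section Normalization

variable {K L F : Type*} [Field K] [LieRing L] [LieAlgebra K L] [Field F] [Algebra K F]
  {m : ℕ} {s₁ s₂ : F →ₗ[K] L} {π : L →ₗ[K] F}

namespace IsCoordinates

/-- The roles of `s₁` and `s₂` are symmetric, up to the sign of the determinant. -/
lemma swap (hc : IsCoordinates s₁ s₂ π) : IsCoordinates s₂ s₁ (-π) where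
  lie_left := hc.lie_right
  lie_right := hc.lie_left
  map_lie a b := by rw [LinearMap.neg_apply, ← map_neg, lie_skew, hc.map_lie, mul_comm]
  map_eq_zero y hy := by rw [LinearMap.neg_apply, neg_eq_zero, hc.map_eq_zero y hy]
  exists_sub x := by
    obtain ⟨a, b, hab⟩ := hc.exists_sub x
    exact ⟨b, a, by rwa [sub_right_comm]⟩

variable (hc : IsCoordinates s₁ s₂ π)
include hc

/-- Modulo the center, the derived subalgebra consists of the elements `⁅s₁ 1, s₂ c⁆`. -/
lemma lie_eq_of_mem_der (x : L) {y : L} (hy : y ∈ der K L) :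
    ⁅x, y⁆ = ⁅x, ⁅s₁ 1, s₂ (π y)⁆⁆ := by
  have h1 : y - ⁅s₁ 1, s₂ (π y)⁆ ∈ ctr K L := by
    rw [← hc.map_eq_zero _ (sub_mem hy (lie_mem_der _ _)), map_sub, hc.map_lie, one_mul,
      sub_self]
  rw [← sub_eq_zero, ← lie_sub, mem_ctr'.1 h1]

/-- By the Jacobi identity, the bracket of `s₁ a` with an element of the derived subalgebra depends
only on the product of coordinates in `F`. -/
lemma lie_left_eq (a : F) {y : L} (hy : y ∈ der K L) :
    ⁅s₁ a, y⁆ = ⁅s₁ (a * π y), ⁅s₁ 1, s₂ 1⁆⁆ := by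
  have key (a b c : F) :
      ⁅s₁ a, ⁅s₁ 1, s₂ (b * c)⁆⁆ = ⁅s₁ b, ⁅s₁ 1, s₂ (a * c)⁆⁆ := by
    rw [← hc.map_lie b c, ← hc.map_lie a c, ← hc.lie_eq_of_mem_der _ (lie_mem_der _ _),
      ← hc.lie_eq_of_mem_der _ (lie_mem_der _ _), leibniz_lie, mem_ctr.1 (hc.lie_left a b),
      zero_add]
  rw [hc.lie_eq_of_mem_der _ hy]
  have h1 := key a 1 (π y)
  have h2 := key (a * π y) 1 1
  rw [one_mul] at h1 h2
  rw [h1, h2, mul_one]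

lemma lie_right_eq (a : F) {y : L} (hy : y ∈ der K L) :
    ⁅s₂ a, y⁆ = ⁅s₂ (a * π y), ⁅s₁ 1, s₂ 1⁆⁆ := by
  have h1 := hc.swap.lie_left_eq a hy
  rw [h1, ← lie_skew (s₁ 1), lie_neg, LinearMap.neg_apply, mul_neg, map_neg, neg_lie]

variable (h : IsBreadthThree K L (2 * m))
include h

lemma eq_zero_of_mem_der {a b : F} (hx : s₁ a + s₂ b ∈ der K L) : a = 0 ∧ b = 0 := by
  have h1 (y : L) : π ⁅s₁ a + s₂ b, y⁆ = 0 :=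
    (hc.map_eq_zero _ (lie_mem_der _ _)).2 (h.der_le_ctr2 hx y)
  have h2 := h1 (s₂ 1)
  have h3 := h1 (s₁ 1)
  rw [add_lie, map_add, hc.map_lie, (hc.map_eq_zero _ (lie_mem_der _ _)).2 (hc.lie_right _ _)]
    at h2
  rw [add_lie, map_add, ← lie_skew (s₂ b), map_neg, hc.map_lie,
    (hc.map_eq_zero _ (lie_mem_der _ _)).2 (hc.lie_left _ _)] at h3
  constructor
  · linear_combination h2
  · linear_combination -h3

/-- Adding to `s₁` and `s₂` maps into the derived subalgebra gives coordinates again. -/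
lemma add {g₁ g₂ : F →ₗ[K] L} (h₁ : ∀ a, g₁ a ∈ der K L) (h₂ : ∀ a, g₂ a ∈ der K L) :
    IsCoordinates (s₁ + g₁) (s₂ + g₂) π := by
  have hl {x y : L} (hx : x ∈ der K L) : ⁅x, y⁆ ∈ ctr K L := h.der_le_ctr2 hx y
  have hr {x y : L} (hx : x ∈ der K L) : ⁅y, x⁆ ∈ ctr K L := lie_mem_ctr_comm.1 (hl hx)
  have h0 {x y : L} (hx : ⁅x, y⁆ ∈ ctr K L) : π ⁅x, y⁆ = 0 :=
    (hc.map_eq_zero _ (lie_mem_der _ _)).2 hx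
  refine ⟨fun a b => ?_, fun a b => ?_, fun a b => ?_, hc.map_eq_zero, fun x => ?_⟩
  · simp only [LinearMap.add_apply, add_lie, lie_add]
    exact add_mem (add_mem (hc.lie_left a b) (hl (h₁ a))) (add_mem (hr (h₁ b)) (hl (h₁ a)))
  · simp only [LinearMap.add_apply, add_lie, lie_add]
    exact add_mem (add_mem (hc.lie_right a b) (hl (h₂ a))) (add_mem (hr (h₂ b)) (hl (h₂ a)))
  · simp only [LinearMap.add_apply, add_lie, lie_add, map_add, hc.map_lie, h0 (hl (h₁ a)),
      h0 (hr (h₂ b)), add_zero]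
  · obtain ⟨a, b, hab⟩ := hc.exists_sub x
    refine ⟨a, b, ?_⟩
    have := sub_mem (sub_mem hab (h₁ a)) (h₂ b)
    simp only [LinearMap.add_apply]
    convert! this using 1
    abel

variable [FiniteDimensional K L] [Finite K] (hq : 3 ≤ Nat.card K) (hm : 1 ≤ m)
include hq hm

lemma eq_zero_of_lie_add_lie {a b : F}
    (hab : ⁅s₁ a, ⁅s₁ 1, s₂ 1⁆⁆ + ⁅s₂ b, ⁅s₁ 1, s₂ 1⁆⁆ = 0) : a = 0 ∧ b = 0 := by
  rw [← add_lie] at hab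
  refine hc.eq_zero_of_mem_der h
    (h.mem_der_of_lie_eq_zero hq hm (lie_mem_der (s₁ 1) (s₂ 1)) ?_ hab)
  rw [← hc.map_eq_zero _ (lie_mem_der _ _), hc.map_lie]
  simp

/-- Two elements on the same line of `F × F` commute modulo the center, and their bracket lies on
the corresponding line of the center. -/
lemma exists_lie_line (a b s : F) : ∃ f, ⁅s₁ a + s₂ (a * s), s₁ b + s₂ (b * s)⁆ =
    ⁅s₁ f, ⁅s₁ 1, s₂ 1⁆⁆ + ⁅s₂ (f * s), ⁅s₁ 1, s₂ 1⁆⁆ := by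
  by_cases ha : a = 0
  · exact ⟨0, by simp [ha]⟩
  have h1 : s₁ a + s₂ (a * s) ∉ der K L := fun hx => ha (hc.eq_zero_of_mem_der h hx).1
  have h2 : ⁅s₁ a + s₂ (a * s), s₁ b + s₂ (b * s)⁆ ∈ ctr K L := by
    rw [← hc.map_eq_zero _ (lie_mem_der _ _), add_lie, lie_add, lie_add, map_add, map_add,
      map_add, hc.map_lie, ← lie_skew (s₂ _) (s₁ b), map_neg, hc.map_lie,
      (hc.map_eq_zero _ (lie_mem_der _ _)).2 (hc.lie_left _ _),
      (hc.map_eq_zero _ (lie_mem_der _ _)).2 (hc.lie_right _ _)]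
    ring
  obtain ⟨g, hg, hg'⟩ := h.exists_mem_der_lie_eq hq hm h1 h2
  refine ⟨a * π g, ?_⟩
  rw [hg', add_lie, hc.lie_left_eq _ hg, hc.lie_right_eq _ hg, mul_right_comm]

lemma exists_lie_left (a b : F) : ∃ f, ⁅s₁ a, s₁ b⁆ = ⁅s₁ f, ⁅s₁ 1, s₂ 1⁆⁆ := by
  obtain ⟨f, hf⟩ := hc.exists_lie_line h hq hm a b 0
  exact ⟨f, by simpa using hf⟩

lemma exists_lie_right (a b : F) : ∃ f, ⁅s₂ a, s₂ b⁆ = ⁅s₂ f, ⁅s₁ 1, s₂ 1⁆⁆ := by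
  obtain ⟨f, hf⟩ := hc.swap.exists_lie_left h hq hm a b
  exact ⟨-f, by rw [hf, ← lie_skew (s₁ 1), map_neg, neg_lie, lie_neg, neg_neg]⟩

/-- Comparing `exists_lie_line` for the slopes `s` and `lam * s`, with `lam ≠ 0, 1` in the ground
field, separates its part that is linear in `s` from its part that is quadratic in `s`. -/
lemma exists_cross {a b s g₁ g₂ : F} (h₁ : ⁅s₁ a, s₁ b⁆ = ⁅s₁ g₁, ⁅s₁ 1, s₂ 1⁆⁆)
    (h₂ : ⁅s₂ (a * s), s₂ (b * s)⁆ = ⁅s₂ g₂, ⁅s₁ 1, s₂ 1⁆⁆) :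
    ∃ f, s * f = g₂ ∧ ⁅s₁ a, s₂ (b * s)⁆ - ⁅s₁ b, s₂ (a * s)⁆ =
      ⁅s₁ f, ⁅s₁ 1, s₂ 1⁆⁆ + ⁅s₂ (s * g₁), ⁅s₁ 1, s₂ 1⁆⁆ := by
  classical
  obtain ⟨lam, hl0, hl1⟩ : ∃ lam : K, lam ≠ 0 ∧ lam ≠ 1 := by
    have := Fintype.ofFinite K
    rw [Nat.card_eq_fintype_card] at hq
    obtain ⟨x, hx⟩ : ∃ x, x ∉ ({0, 1} : Finset K) := by
      by_contra! hne
      have := Finset.card_le_card (fun x _ => hne x : (Finset.univ : Finset K) ⊆ {0, 1})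
      rw [Finset.card_univ] at this
      have := Finset.card_le_two (a := (0 : K)) (b := 1)
      omega
    exact ⟨x, by simpa using hx⟩
  obtain ⟨f, hf⟩ := hc.exists_lie_line h hq hm a b s
  obtain ⟨f', hf'⟩ := hc.exists_lie_line h hq hm a b (lam • s)
  set t := ⁅s₁ 1, s₂ 1⁆
  -- The relation with slope `lam • s` minus `lam` times the one with slope `s`.
  simp only [add_lie, lie_add, mul_smul_comm, map_smul, smul_lie, lie_smul, h₁, h₂] at hf hf'
  rw [← lie_skew (s₂ (a * s)) (s₁ b)] at hf hf'
  have e1 : ⁅s₁ (lam • (f - g₁) - (f' - g₁)), t⁆ +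
      ⁅s₂ (lam • (f * s - g₂) - lam • (f' * s - lam • g₂)), t⁆ = 0 := by
    simp only [map_sub, sub_lie, map_smul, smul_lie]
    linear_combination (norm := module) hf' - lam • hf
  obtain ⟨e2, e3⟩ := hc.eq_zero_of_lie_add_lie h hq hm e1
  rw [← smul_sub, smul_eq_zero, or_iff_right hl0] at e3
  have e4 : (1 - lam) • (f * s - (g₁ * s + g₂)) = 0 := by
    simp only [Algebra.smul_def, map_sub, map_one] at e2 e3 ⊢
    linear_combination e3 - s * e2
  rw [smul_eq_zero, or_iff_right (sub_ne_zero.2 hl1.symm)] at e4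
  refine ⟨f - g₁, by linear_combination e4, ?_⟩
  have e5 : f * s = s * g₁ + g₂ := by linear_combination e4
  rw [e5, map_add, add_lie] at hf
  rw [map_sub, sub_lie]
  linear_combination (norm := module) hf

/-- The brackets of the elements `s₁ a` can be removed by adding to `s₁` a map into the derived
subalgebra. -/
lemma exists_correction : ∃ g : F →ₗ[K] L, (∀ a, g a ∈ der K L) ∧
    ∀ a b, ⁅s₁ a, s₁ b⁆ = ⁅s₁ b, g a⁆ - ⁅s₁ a, g b⁆ := by
  -- Applying `exists_cross` to `(a, b, 1)`, `(a, 1, b)` and `(b, 1, a)` eliminates the mixed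
  -- brackets and leaves `γ a b = b * γ a 1 - a * γ b 1`; the correction is then `γ · 1`.
  choose γ hγ using hc.exists_lie_left h hq hm
  choose δ hδ using hc.exists_lie_right h hq hm
  have hγ1 (a b : F) : γ a b = b * γ a 1 - a * γ b 1 := by
    obtain ⟨f₁, -, e₁⟩ := hc.exists_cross h hq hm (s := 1) (hγ a b) (hδ _ _)
    obtain ⟨f₂, -, e₂⟩ := hc.exists_cross h hq hm (s := b) (hγ a 1) (hδ _ _)
    obtain ⟨f₃, -, e₃⟩ := hc.exists_cross h hq hm (s := a) (hγ b 1) (hδ _ _)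
    rw [mul_one, mul_one, one_mul] at e₁
    rw [one_mul] at e₂ e₃
    rw [mul_comm b a] at e₃
    have e : ⁅s₁ (f₁ - (f₂ - f₃)), ⁅s₁ 1, s₂ 1⁆⁆ +
        ⁅s₂ (γ a b - (b * γ a 1 - a * γ b 1)), ⁅s₁ 1, s₂ 1⁆⁆ = 0 := by
      simp only [map_sub, sub_lie]
      linear_combination (norm := module) e₂ - e₃ - e₁
    exact sub_eq_zero.1 (hc.eq_zero_of_lie_add_lie h hq hm e).2
  let ψ : F →ₗ[K] L := (-ad K L ⁅s₁ 1, s₂ 1⁆) ∘ₗ s₁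
  have hψ (a : F) : ψ a = ⁅s₁ a, ⁅s₁ 1, s₂ 1⁆⁆ := lie_skew _ _
  obtain ⟨ρ, hρ⟩ := LinearMap.exists_leftInverse_of_injective ψ (by
    rw [LinearMap.ker_eq_bot']
    intro a ha
    refine (hc.eq_zero_of_lie_add_lie h hq hm (a := a) (b := 0) ?_).1
    rw [← hψ, ha, map_zero, zero_lie, add_zero])
  let η : F →ₗ[K] F := ρ ∘ₗ (-ad K L (s₁ 1)) ∘ₗ s₁
  have hη (a : F) : η a = γ a 1 := by
    have h1 : (-ad K L (s₁ 1)) (s₁ a) = ψ (γ a 1) := by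
      rw [hψ, ← hγ]; exact lie_skew _ _
    change ρ ((-ad K L (s₁ 1)) (s₁ a)) = _
    rw [h1]
    exact LinearMap.congr_fun hρ _
  refine ⟨ad K L (s₁ 1) ∘ₗ s₂ ∘ₗ η, fun a => lie_mem_der _ _, fun a b => ?_⟩
  simp only [LinearMap.comp_apply, ad_apply]
  rw [hc.lie_left_eq b (lie_mem_der _ _), hc.lie_left_eq a (lie_mem_der _ _)]
  simp only [hc.map_lie, hη, one_mul]
  rw [hγ, hγ1, map_sub, sub_lie]

/-- Coordinates can be chosen such that the bracket is the determinant form exactly, not only modulo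
the center. -/
lemma exists_normalized : ∃ s₁' s₂' : F →ₗ[K] L, IsCoordinates s₁' s₂' π ∧
    (∀ a b, ⁅s₁' a, s₁' b⁆ = 0) ∧ (∀ a b, ⁅s₂' a, s₂' b⁆ = 0) ∧
    ∀ a b, ⁅s₁' a, s₂' b⁆ = ⁅s₁' 1, s₂' (a * b)⁆ := by
  obtain ⟨g₁, hg₁, e₁⟩ := hc.exists_correction h hq hm
  obtain ⟨g₂, hg₂, e₂⟩ := hc.swap.exists_correction h hq hm
  have hc' := hc.add h hg₁ hg₂
  have hz {s g : F →ₗ[K] L} (hg : ∀ a, g a ∈ der K L)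
      (e : ∀ a b, ⁅s a, s b⁆ = ⁅s b, g a⁆ - ⁅s a, g b⁆) (a b : F) :
      ⁅(s + g) a, (s + g) b⁆ = 0 := by
    simp only [LinearMap.add_apply, add_lie, lie_add]
    rw [e, h.lie_eq_zero_of_mem_der (hg a) (hg b), ← lie_skew (g a)]
    abel
  refine ⟨s₁ + g₁, s₂ + g₂, hc', hz hg₁ e₁, hz hg₂ e₂, fun a b => ?_⟩
  by_cases hb : b = 0
  · simp [hb]
  obtain ⟨f, hf, e⟩ := hc'.exists_cross h hq hm (a := a) (b := 1) (s := b) (g₁ := 0) (g₂ := 0)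
    (by rw [hz hg₁ e₁, map_zero, zero_lie]) (by rw [hz hg₂ e₂, map_zero, zero_lie])
  obtain rfl : f = 0 := (mul_eq_zero.1 hf).resolve_left hb
  rwa [mul_zero, map_zero, map_zero, zero_lie, add_zero, one_mul, sub_eq_zero] at e

end IsCoordinates

end Normalization

/-! ### The free nilpotent algebra on two generators -/

/-- The free `3`-step nilpotent Lie algebra over `F` on two generators, in coordinates: `a`, `b`
are the coefficients of the generators `X` and `Y`, and `c`, `d`, `e` those of `⁅X, Y⁆`,
`⁅X, ⁅X, Y⁆⁆` and `⁅Y, ⁅X, Y⁆⁆`. -/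
@[ext]
structure FreeNil (F : Type*) where
  a : F
  b : F
  c : F
  d : F
  e : F

namespace FreeNil

variable {K F : Type*} [Field K] [Field F] [Algebra K F]

/-- The coordinates of an element as a tuple. -/
def equivProd (F : Type*) : FreeNil F ≃ F × F × F × F × F where
  toFun x := (x.a, x.b, x.c, x.d, x.e)
  invFun y := ⟨y.1, y.2.1, y.2.2.1, y.2.2.2.1, y.2.2.2.2⟩
  left_inv _ := rfl
  right_inv _ := rfl

instance : AddCommGroup (FreeNil F) := (equivProd F).addCommGroup

instance : Module K (FreeNil F) := (equivProd F).module K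

@[simp] lemma zero_a : (0 : FreeNil F).a = 0 := rfl
@[simp] lemma zero_b : (0 : FreeNil F).b = 0 := rfl
@[simp] lemma zero_c : (0 : FreeNil F).c = 0 := rfl
@[simp] lemma zero_d : (0 : FreeNil F).d = 0 := rfl
@[simp] lemma zero_e : (0 : FreeNil F).e = 0 := rfl
@[simp] lemma add_a (x y : FreeNil F) : (x + y).a = x.a + y.a := rfl
@[simp] lemma add_b (x y : FreeNil F) : (x + y).b = x.b + y.b := rfl
@[simp] lemma add_c (x y : FreeNil F) : (x + y).c = x.c + y.c := rfl
@[simp] lemma add_d (x y : FreeNil F) : (x + y).d = x.d + y.d := rfl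
@[simp] lemma add_e (x y : FreeNil F) : (x + y).e = x.e + y.e := rfl
@[simp] lemma smul_a (r : K) (x : FreeNil F) : (r • x).a = r • x.a := rfl
@[simp] lemma smul_b (r : K) (x : FreeNil F) : (r • x).b = r • x.b := rfl
@[simp] lemma smul_c (r : K) (x : FreeNil F) : (r • x).c = r • x.c := rfl
@[simp] lemma smul_d (r : K) (x : FreeNil F) : (r • x).d = r • x.d := rfl
@[simp] lemma smul_e (r : K) (x : FreeNil F) : (r • x).e = r • x.e := rfl

instance : Bracket (FreeNil F) (FreeNil F) where
  bracket x y :=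
    ⟨0, 0, x.a * y.b - x.b * y.a, x.a * y.c - x.c * y.a, x.b * y.c - x.c * y.b⟩

@[simp] lemma lie_a (x y : FreeNil F) : ⁅x, y⁆.a = 0 := rfl
@[simp] lemma lie_b (x y : FreeNil F) : ⁅x, y⁆.b = 0 := rfl
@[simp] lemma lie_c (x y : FreeNil F) : ⁅x, y⁆.c = x.a * y.b - x.b * y.a := rfl
@[simp] lemma lie_d (x y : FreeNil F) : ⁅x, y⁆.d = x.a * y.c - x.c * y.a := rfl
@[simp] lemma lie_e (x y : FreeNil F) : ⁅x, y⁆.e = x.b * y.c - x.c * y.b := rfl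

instance : LieRing (FreeNil F) where
  add_lie x y z := by ext <;> simp <;> ring
  lie_add x y z := by ext <;> simp <;> ring
  lie_self x := by ext <;> simp <;> ring
  leibniz_lie x y z := by ext <;> simp <;> ring

instance : LieAlgebra K (FreeNil F) where
  lie_smul r x y := by ext <;> simp [Algebra.smul_def] <;> ring

variable (K) in
/-- The coordinates of an element, as a linear equivalence. -/
def linearEquivProd : FreeNil F ≃ₗ[K] F × F × F × F × F :=
  { equivProd F with
    map_add' := fun _ _ => rfl
    map_smul' := fun _ _ => rfl }

instance [FiniteDimensional K F] : FiniteDimensional K (FreeNil F) :=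
  Module.Finite.equiv (linearEquivProd K).symm

lemma mem_ctr_iff {x : FreeNil F} : x ∈ ctr K (FreeNil F) ↔ x.a = 0 ∧ x.b = 0 ∧ x.c = 0 := by
  rw [mem_ctr]
  refine ⟨fun h => ?_, fun h y => by ext <;> simp [h.1, h.2.1, h.2.2]⟩
  have h1 := h ⟨1, 0, 0, 0, 0⟩
  have h2 := h ⟨0, 1, 0, 0, 0⟩
  refine ⟨?_, ?_, ?_⟩
  · simpa using congrArg FreeNil.c h2
  · simpa using congrArg FreeNil.c h1
  · simpa using congrArg FreeNil.d h1

lemma breadth_eq_of_surjective [FiniteDimensional K F] {x : FreeNil F}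
    (φ : FreeNil F →ₗ[K] F × F) (hφ : Function.Surjective φ)
    (hker : ∀ y, φ y = 0 ↔ ⁅x, y⁆ = 0) : breadth K x = 2 * finrank K F := by
  have h1 : (centralizer K x).toSubmodule = LinearMap.ker φ := by
    ext y
    exact (hker y).symm
  unfold breadth
  rw [h1, (φ.quotKerEquivOfSurjective hφ).finrank_eq, finrank_prod, two_mul]

/-- Noncentral elements have breadth `2 * [F : K]`: two of the three nonzero components of
`⁅x, y⁆` can be prescribed, and they determine the third. -/
lemma breadth_eq [FiniteDimensional K F] {x : FreeNil F} (hx : x ∉ ctr K (FreeNil F)) :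
    breadth K x = 2 * finrank K F := by
  let πc : FreeNil F →ₗ[K] F := ⟨⟨FreeNil.c, fun _ _ => rfl⟩, fun _ _ => rfl⟩
  let πd : FreeNil F →ₗ[K] F := ⟨⟨FreeNil.d, fun _ _ => rfl⟩, fun _ _ => rfl⟩
  let πe : FreeNil F →ₗ[K] F := ⟨⟨FreeNil.e, fun _ _ => rfl⟩, fun _ _ => rfl⟩
  rw [mem_ctr_iff] at hx
  by_cases ha : x.a = 0
  · by_cases hb : x.b = 0
    · have hc : x.c ≠ 0 := fun hc => hx ⟨ha, hb, hc⟩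
      refine breadth_eq_of_surjective ((πd.prod πe) ∘ₗ ad K _ x) (fun z => ?_) (fun y => ?_)
      · refine ⟨⟨-z.1 / x.c, -z.2 / x.c, 0, 0, 0⟩, Prod.ext ?_ ?_⟩
        · change x.a * 0 - x.c * (-z.1 / x.c) = z.1
          field_simp; ring
        · change x.b * 0 - x.c * (-z.2 / x.c) = z.2
          field_simp; ring
      · change (⁅x, y⁆.d, ⁅x, y⁆.e) = (0, 0) ↔ _
        rw [Prod.mk.injEq, FreeNil.ext_iff]
        simp [ha, hb]
    · refine breadth_eq_of_surjective ((πc.prod πe) ∘ₗ ad K _ x) (fun z => ?_) (fun y => ?_)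
      · refine ⟨⟨-z.1 / x.b, 0, z.2 / x.b, 0, 0⟩, Prod.ext ?_ ?_⟩
        · change x.a * 0 - x.b * (-z.1 / x.b) = z.1
          field_simp; ring
        · change x.b * (z.2 / x.b) - x.c * 0 = z.2
          field_simp; ring
      · change (⁅x, y⁆.c, ⁅x, y⁆.e) = (0, 0) ↔ _
        rw [Prod.mk.injEq, FreeNil.ext_iff]
        simp only [lie_a, lie_b, lie_c, lie_d, lie_e, zero_a, zero_b, zero_c, zero_d, zero_e,
          true_and]
        refine ⟨fun h => ⟨h.1, ?_, h.2⟩, fun h => ⟨h.1, h.2.2⟩⟩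
        refine (mul_eq_zero.1 ?_).resolve_left hb
        linear_combination x.a * h.2 + x.c * h.1
  · refine breadth_eq_of_surjective ((πc.prod πd) ∘ₗ ad K _ x) (fun z => ?_) (fun y => ?_)
    · refine ⟨⟨0, z.1 / x.a, z.2 / x.a, 0, 0⟩, Prod.ext ?_ ?_⟩
      · change x.a * (z.1 / x.a) - x.b * 0 = z.1
        field_simp; ring
      · change x.a * (z.2 / x.a) - x.c * 0 = z.2
        field_simp; ring
    · change (⁅x, y⁆.c, ⁅x, y⁆.d) = (0, 0) ↔ _
      rw [Prod.mk.injEq, FreeNil.ext_iff]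
      simp only [lie_a, lie_b, lie_c, lie_d, lie_e, zero_a, zero_b, zero_c, zero_d, zero_e,
        true_and]
      refine ⟨fun h => ⟨h.1, h.2, ?_⟩, fun h => ⟨h.1, h.2.1⟩⟩
      refine (mul_eq_zero.1 ?_).resolve_left ha
      linear_combination x.b * h.2 - x.c * h.1

end FreeNil

/-! ### Nilpotency class and breadth -/

section Nilpotency

variable {K L : Type*} [Field K] [LieRing L] [LieAlgebra K L]

lemma breadth_eq_zero {x : L} (hx : x ∈ ctr K L) : breadth K x = 0 := by
  have h1 : (centralizer K x).toSubmodule = ⊤ := eq_top_iff.2 fun y _ => mem_ctr.1 hx y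
  unfold breadth
  rw [h1]
  exact finrank_zero_of_subsingleton

lemma breadth_eq_finrank_range (x : L) :
    breadth K x = finrank K (LinearMap.range (ad K L x)) :=
  (ad K L x).quotKerEquivRange.finrank_eq

lemma lcs_one : (LieModule.lowerCentralSeries K L L 1).toSubmodule = der K L := by
  rw [LieModule.lowerCentralSeries_succ]
  rfl

lemma lie_mem_lcs {k : ℕ} (x : L) {y : L} (hy : y ∈ LieModule.lowerCentralSeries K L L k) :
    ⁅x, y⁆ ∈ LieModule.lowerCentralSeries K L L (k + 1) := by
  rw [LieModule.lowerCentralSeries_succ]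
  exact LieSubmodule.lie_mem_lie (LieSubmodule.mem_top x) hy

lemma lcs_le_iff {k : ℕ} {N : LieSubmodule K L L} :
    LieModule.lowerCentralSeries K L L (k + 1) ≤ N ↔
      ∀ x : L, ∀ y ∈ LieModule.lowerCentralSeries K L L k, ⁅x, y⁆ ∈ N := by
  rw [LieModule.lowerCentralSeries_succ, LieSubmodule.lieIdeal_oper_eq_span,
    LieSubmodule.lieSpan_le]
  constructor
  · intro h x y hy
    exact h ⟨⟨x, LieSubmodule.mem_top x⟩, ⟨y, hy⟩, rfl⟩
  · rintro h _ ⟨x, y, rfl⟩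
    exact h _ _ y.2

lemma lcs_three_eq_bot_iff : LieModule.lowerCentralSeries K L L 3 = ⊥ ↔
    ∀ x y z w : L, ⁅x, ⁅y, ⁅z, w⁆⁆⁆ = 0 := by
  constructor
  · intro h x y z w
    rw [← LieSubmodule.mem_bot (R := K) (L := L), ← h]
    exact lie_mem_lcs _ (lie_mem_lcs _ (lie_mem_lcs _ (LieSubmodule.mem_top w)))
  · intro h
    have h2 : LieModule.lowerCentralSeries K L L 2 ≤ LieAlgebra.center K L := by
      rw [lcs_le_iff]
      intro x y hy
      have hy' : y ∈ ctr2 K L := der_le_ctr2_of_lie_lie_lie h (by rwa [← lcs_one])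
      exact lie_mem_ctr_comm.1 (hy' x)
    rw [eq_bot_iff, lcs_le_iff]
    intro x y hy
    rw [LieSubmodule.mem_bot]
    exact mem_ctr'.1 (h2 hy) x

lemma lcs_two_eq_bot_iff : LieModule.lowerCentralSeries K L L 2 = ⊥ ↔ ctr2 K L = ⊤ := by
  rw [eq_bot_iff, lcs_le_iff, eq_top_iff]
  constructor
  · intro h x _ y
    rw [mem_ctr']
    intro z
    rw [← LieSubmodule.mem_bot (R := K) (L := L)]
    exact h _ _ (lie_mem_lcs _ (LieSubmodule.mem_top y))
  · intro h x y hy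
    rw [LieSubmodule.mem_bot]
    exact lie_eq_zero_of_mem_ctr2 (h (Submodule.mem_top))
      (by rwa [← lcs_one])

lemma isStepNilpotent_three_iff : IsStepNilpotent L 3 ↔
    (∀ x y z w : L, ⁅x, ⁅y, ⁅z, w⁆⁆⁆ = 0) ∧ ∃ x : L, x ∉ ctr2 K L := by
  unfold IsStepNilpotent
  rw [LieModule.nilpotencyLength_eq_succ_iff K, lcs_three_eq_bot_iff, Ne, lcs_two_eq_bot_iff,
    Submodule.eq_top_iff', not_forall]
  refine ⟨fun h => h.2, fun h => ⟨?_, h⟩⟩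
  have h1 : LieModule.IsNilpotent L L :=
    (LieModule.isNilpotent_iff K L L).2 ⟨3, lcs_three_eq_bot_iff.2 h.1⟩
  exact h1

lemma IsThreeStepStem.isBreadthThree {n : ℕ} (h : IsThreeStepStem K L n) :
    IsBreadthThree K L n := by
  have := h.finiteDimensional
  obtain ⟨h1, h2⟩ := isStepNilpotent_three_iff (K := K).1 h.threeStep
  refine ⟨h1, h2, h.stem, fun x hx => ?_⟩
  rw [← breadth_eq_finrank_range]
  have h3 := (h.breadthType.2 _).2 ⟨x, rfl⟩
  simp only [List.mem_cons, List.not_mem_nil, or_false] at h3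
  refine h3.resolve_left fun h0 => hx ?_
  rw [breadth_eq_finrank_range, Submodule.finrank_eq_zero, LinearMap.range_eq_bot] at h0
  exact mem_ctr.2 fun y => LinearMap.congr_fun h0 y

end Nilpotency

/-! ### Existence and uniqueness -/

lemma FreeNil.isThreeStepStem {K F : Type*} [Field K] [Field F] [Algebra K F]
    [FiniteDimensional K F] : IsThreeStepStem K (FreeNil F) (2 * finrank K F) where
  finiteDimensional := inferInstance
  threeStep := by
    rw [isStepNilpotent_three_iff (K := K)]
    refine ⟨fun x y z w => by ext <;> simp, ⟨1, 0, 0, 0, 0⟩, fun h => ?_⟩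
    have h1 := mem_ctr_iff.1 (h ⟨0, 1, 0, 0, 0⟩)
    simp at h1
  stem := by
    intro x hx
    obtain ⟨ha, hb, hc⟩ := mem_ctr_iff.1 (show x ∈ ctr K (FreeNil F) from hx)
    have h1 : x = ⁅(⟨1, 0, 0, 0, 0⟩ : FreeNil F), (⟨0, 0, x.d, 0, 0⟩ : FreeNil F)⁆ +
        ⁅(⟨0, 1, 0, 0, 0⟩ : FreeNil F), (⟨0, 0, x.e, 0, 0⟩ : FreeNil F)⁆ := by
      ext <;> simp [ha, hb, hc]
    have h2 : x ∈ der K (FreeNil F) := by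
      rw [h1]
      exact add_mem (lie_mem_der _ _) (lie_mem_der _ _)
    exact h2
  breadthType := by
    refine ⟨by simpa using finrank_pos, fun b => ?_⟩
    simp only [List.mem_cons, List.not_mem_nil, or_false]
    constructor
    · rintro (rfl | rfl)
      · exact ⟨0, breadth_eq_zero (zero_mem _)⟩
      · exact ⟨⟨1, 0, 0, 0, 0⟩, breadth_eq (by rw [mem_ctr_iff]; simp)⟩
    · rintro ⟨x, rfl⟩
      by_cases hx : x ∈ ctr K (FreeNil F)
      · exact Or.inl (breadth_eq_zero hx)
      · exact Or.inr (breadth_eq hx)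

/-- Normalized coordinates define a Lie algebra isomorphism from the free algebra: its range is
everything because `L` is spanned by the images of `s₁` and `s₂` and the derived subalgebra, whose
elements are brackets of such elements. -/
theorem IsBreadthThree.nonempty_lieEquiv {K L F : Type*} [Field K] [Finite K] [LieRing L]
    [LieAlgebra K L] [FiniteDimensional K L] [Field F] [Algebra K F] {m : ℕ}
    (h : IsBreadthThree K L (2 * m)) (hq : 3 ≤ Nat.card K) (hm : 1 ≤ m) (hF : finrank K F = m) :
    Nonempty (L ≃ₗ⁅K⁆ FreeNil F) := by
  obtain ⟨_, _, π, hc₀⟩ := h.exists_isCoordinates (F := F) hq hm hF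
  obtain ⟨s₁, s₂, hc, h₁, h₂, h₁₂⟩ := hc₀.exists_normalized h hq hm
  have h₂₁ (a b : F) : ⁅s₂ a, s₁ b⁆ = -⁅s₁ 1, s₂ (b * a)⁆ := by rw [← lie_skew, h₁₂]
  have hπt (c : F) : π ⁅s₁ 1, s₂ c⁆ = c := by rw [hc.map_lie, one_mul]
  have hl (a : F) (x y : L) :
      ⁅s₁ a, ⁅x, y⁆⁆ = ⁅s₁ (a * π ⁅x, y⁆), ⁅s₁ 1, s₂ 1⁆⁆ := hc.lie_left_eq a (lie_mem_der _ _)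
  have hr (a : F) (x y : L) :
      ⁅s₂ a, ⁅x, y⁆⁆ = ⁅s₂ (a * π ⁅x, y⁆), ⁅s₁ 1, s₂ 1⁆⁆ := hc.lie_right_eq a (lie_mem_der _ _)
  have hd (x y z w : L) : ⁅⁅x, y⁆, ⁅z, w⁆⁆ = 0 :=
    h.lie_eq_zero_of_mem_der (lie_mem_der _ _) (lie_mem_der _ _)
  have hz (x y z w : L) : ⁅⁅x, ⁅y, z⁆⁆, w⁆ = 0 := by
    rw [← lie_skew, h.lie_lie_lie, neg_zero]
  have hz' (x y z w : L) : ⁅w, ⁅x, ⁅y, z⁆⁆⁆ = 0 := h.lie_lie_lie _ _ _ _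
  let Φ : FreeNil F →ₗ⁅K⁆ L :=
    { toFun := fun x => s₁ x.a + s₂ x.b + ⁅s₁ 1, s₂ x.c⁆ + ⁅s₁ x.d, ⁅s₁ 1, s₂ 1⁆⁆ +
        ⁅s₂ x.e, ⁅s₁ 1, s₂ 1⁆⁆
      map_add' := fun x y => by
        simp only [FreeNil.add_a, FreeNil.add_b, FreeNil.add_c, FreeNil.add_d, FreeNil.add_e,
          map_add, add_lie, lie_add]
        abel
      map_smul' := fun r x => by
        simp only [FreeNil.smul_a, FreeNil.smul_b, FreeNil.smul_c, FreeNil.smul_d,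
          FreeNil.smul_e, map_smul, smul_lie, lie_smul, smul_add, RingHom.id_apply]
      map_lie' := fun {x y} => by
        have e1 (c a : F) : ⁅⁅s₁ 1, s₂ c⁆, s₁ a⁆ = -⁅s₁ (a * c), ⁅s₁ 1, s₂ 1⁆⁆ := by
          rw [← lie_skew, hl, hπt]
        have e2 (c a : F) : ⁅⁅s₁ 1, s₂ c⁆, s₂ a⁆ = -⁅s₂ (a * c), ⁅s₁ 1, s₂ 1⁆⁆ := by
          rw [← lie_skew, hr, hπt]
        have e3 (a c : F) : ⁅s₁ a, ⁅s₁ 1, s₂ c⁆⁆ = ⁅s₁ (a * c), ⁅s₁ 1, s₂ 1⁆⁆ := by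
          rw [hl, hπt]
        have e4 (a c : F) : ⁅s₂ a, ⁅s₁ 1, s₂ c⁆⁆ = ⁅s₂ (a * c), ⁅s₁ 1, s₂ 1⁆⁆ := by
          rw [hr, hπt]
        simp only [add_lie, lie_add, hz, hz', hd, h₁, h₂, FreeNil.lie_a, FreeNil.lie_b,
          FreeNil.lie_c, FreeNil.lie_d, FreeNil.lie_e, map_zero, zero_add, add_zero]
        rw [h₁₂ x.a, h₂₁ x.b, e1, e2, e3 x.a y.c, e4 x.b y.c, mul_comm y.a x.b, mul_comm y.a x.c,
          mul_comm y.b x.c]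
        simp only [map_sub, sub_lie, lie_sub]
        abel }
  have hΦ (x : FreeNil F) : Φ x = s₁ x.a + s₂ x.b + ⁅s₁ 1, s₂ x.c⁆ +
    ⁅s₁ x.d, ⁅s₁ 1, s₂ 1⁆⁆ + ⁅s₂ x.e, ⁅s₁ 1, s₂ 1⁆⁆ := rfl
  have hinj : Function.Injective Φ := by
    rw [injective_iff_map_eq_zero]
    intro x hx
    rw [hΦ] at hx
    have hab := hc.eq_zero_of_mem_der h (a := x.a) (b := x.b) (by
      have : s₁ x.a + s₂ x.b = -(⁅s₁ 1, s₂ x.c⁆ + ⁅s₁ x.d, ⁅s₁ 1, s₂ 1⁆⁆ +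
          ⁅s₂ x.e, ⁅s₁ 1, s₂ 1⁆⁆) := by
        rw [eq_neg_iff_add_eq_zero, ← hx]; abel
      rw [this]
      exact neg_mem (add_mem (add_mem (lie_mem_der _ _) (lie_mem_der _ _)) (lie_mem_der _ _)))
    rw [hab.1, hab.2, map_zero, map_zero, zero_add, zero_add] at hx
    have hπz (y z w : L) : π ⁅y, ⁅z, w⁆⁆ = 0 :=
      (hc.map_eq_zero _ (lie_mem_der _ _)).2 (mem_ctr.2 (hz y z w))
    have hc0 := congrArg π hx
    rw [map_add, map_add, hπt, hπz, hπz, map_zero, add_zero, add_zero] at hc0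
    rw [hc0, map_zero, lie_zero, zero_add] at hx
    have hde := hc.eq_zero_of_lie_add_lie h hq hm hx
    exact FreeNil.ext hab.1 hab.2 hc0 hde.1 hde.2
  have hsurj : LinearMap.range (Φ : FreeNil F →ₗ[K] L) = ⊤ := by
    have m1 (a : F) : s₁ a ∈ LinearMap.range (Φ : FreeNil F →ₗ[K] L) :=
      ⟨⟨a, 0, 0, 0, 0⟩, by simp [hΦ]⟩
    have m2 (b : F) : s₂ b ∈ LinearMap.range (Φ : FreeNil F →ₗ[K] L) :=
      ⟨⟨0, b, 0, 0, 0⟩, by simp [hΦ]⟩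
    have m3 {x y : L} (hx : x ∈ LinearMap.range (Φ : FreeNil F →ₗ[K] L))
        (hy : y ∈ LinearMap.range (Φ : FreeNil F →ₗ[K] L)) :
        ⁅x, y⁆ ∈ LinearMap.range (Φ : FreeNil F →ₗ[K] L) := by
      obtain ⟨x, rfl⟩ := hx
      obtain ⟨y, rfl⟩ := hy
      exact ⟨⁅x, y⁆, Φ.map_lie x y⟩
    have m4 {x g : L} (hg : g ∈ der K L) (hx : x ∈ LinearMap.range (Φ : FreeNil F →ₗ[K] L)) :
        ⁅x, g⁆ ∈ LinearMap.range (Φ : FreeNil F →ₗ[K] L) := by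
      rw [hc.lie_eq_of_mem_der x hg]
      exact m3 hx (m3 (m1 _) (m2 _))
    have m5 (x : L) : ∃ y ∈ LinearMap.range (Φ : FreeNil F →ₗ[K] L), ∃ g ∈ der K L,
        x = y + g := by
      obtain ⟨a, b, hab⟩ := hc.exists_sub x
      exact ⟨_, add_mem (m1 a) (m2 b), _, hab, by abel⟩
    have m6 : der K L ≤ LinearMap.range (Φ : FreeNil F →ₗ[K] L) := by
      rw [der_eq_span, Submodule.span_le]
      rintro _ ⟨x, y, rfl⟩
      obtain ⟨x, hx, g, hg, rfl⟩ := m5 x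
      obtain ⟨y, hy, k, hk, rfl⟩ := m5 y
      rw [add_lie, lie_add, lie_add, h.lie_eq_zero_of_mem_der hg hk, ← lie_skew g, add_zero]
      exact add_mem (add_mem (m3 hx hy) (m4 hk hx)) (neg_mem (m4 hg hy))
    rw [eq_top_iff]
    rintro x -
    obtain ⟨y, hy, g, hg, rfl⟩ := m5 x
    exact add_mem hy (m6 hg)
  exact ⟨(LieEquiv.ofBijective Φ ⟨hinj, LinearMap.range_eq_top.1 hsurj⟩).symm⟩

end NilLie

theorem theorem1p2 (n : ℕ) (hn : 2 ≤ n) (hne : Even n) (q : ℕ) (hq : 3 ≤ q)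
    (K : Type u) [Field K] [Finite K] (hK : Nat.card K = q) :
    ∃ (V : Type u) (_ : LieRing V) (_ : LieAlgebra K V),
      NilLie.IsThreeStepStem K V n ∧
      ∀ (L : Type v) [LieRing L] [LieAlgebra K L],
        NilLie.IsThreeStepStem K L n → Nonempty (L ≃ₗ⁅K⁆ V) := by
  subst hK
  obtain ⟨m, rfl⟩ := hne
  rw [← two_mul] at hn ⊢
  obtain ⟨p, hp⟩ := CharP.exists K
  have : Fact p.Prime := ⟨CharP.char_is_prime K p⟩
  have : NeZero m := ⟨by omega⟩
  let F : Type u := ULift.{u} (FiniteField.Extension K p m)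
  have hF : Module.finrank K F = m := by
    have h := (ULift.moduleEquiv (R := K) (M := FiniteField.Extension K p m)).finrank_eq
    exact h.trans (FiniteField.finrank_extension K p m)
  have : FiniteDimensional K F := Module.finite_of_finrank_pos (by omega)
  refine ⟨NilLie.FreeNil F, inferInstance, inferInstance, ?_, fun L _ _ hL => ?_⟩
  · have h := NilLie.FreeNil.isThreeStepStem (K := K) (F := F)
    rwa [hF] at h
  · have := hL.finiteDimensional
    exact hL.isBreadthThree.nonempty_lieEquiv hq (by omega) hF
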